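/- Let $n \ge 2$ and let $d=(d_1,\dots,d_n)$ be a probability vector with all $d_i>0$ (a distribution on a finite set $\Omega$ with $|\Omega|=n$). Let $d^\downarrow$ be the vector of the entries of $d$ in non-increasing order. For $1\le i<j\le n$ let $P^{d^\downarrow}(i,j)$ be the $n\times n$ matrix that agrees with the identity matrix except in the rows and columns $i,j$, where it has the block $$\begin{pmatrix} 1-\gamma_{i,j} & 1\\ \gamma_{i,j} & 0\end{pmatrix},\qquad \gamma_{i,j}=d^\downarrow_j/d^\downarrow_i ,$$ and let $P^{d^\downarrow}(i,i)$ be the identity matrix $\mathbb I$. A *$d$-swap* is a matrix $Q^T P^{d^\downarrow}(i,j)\,Q$ with $1\le i\le j\le n$ and $Q$ a permutation matrix such that $Qd=d^\downarrow$. A *$T^d$-transform* is a matrix $(1-\lambda)\mathbb I+\lambda P$ with $P$ a $d$-swap and $0\le\lambda\le1$. Let $\mathcal P_{\mathrm{ETO}}(d)$ be the set of all convex combinations of finite products of $d$-swaps, and let $\mathcal P_{\mathrm{WETO}}(d)$ be the set of all finite products of $T^d$-transforms. **Theorem (Equivalence of the ETO and WETO polytopes).** The following statements are equivalent: (a) $\mathcal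 P_{\mathrm{ETO}}(d)=\mathcal P_{\mathrm{WETO}}(d)$; (b) $|\Omega|=n=2$. -/

import Mathlib

/-- The decreasing rearrangement `d↓` of `d`: its entries arranged in non-increasing order. -/
noncomputable def decreasingRearrangement {n : ℕ} (d : Fin n → ℝ) : Fin n → ℝ :=
  d ∘ Tuple.sort (fun i => -d i)

theorem decreasingRearrangement_antitone {n : ℕ} (d : Fin n → ℝ) :
    Antitone (decreasingRearrangement d) := by
  intro i j hij
  have h := Tuple.monotone_sort (fun i => -d i) hij
  simpa [decreasingRearrangement] using h

/-- The two-level matrix which, for `i ≠ j`, has the `2 × 2` block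
`!![1 - e j / e i, 1; e j / e i, 0]` in the rows and columns `i, j` (in this order) and agrees with
the identity elsewhere; for `i = j` it is the identity matrix. For `e` non-increasing and `i ≤ j`
this is the matrix `P^e(i, j)`. -/
noncomputable def twoLevelSwap {n : ℕ} (e : Fin n → ℝ) (i j : Fin n) :
    Matrix (Fin n) (Fin n) ℝ :=
  if i = j then 1 else Matrix.of fun k l =>
    if k = i ∧ l = i then 1 - e j / e i
    else if k = i ∧ l = j then 1
    else if k = j ∧ l = i then e j / e i
    else if k = j ∧ l = j then 0
    else if k = l then 1 else 0

/-- `P` is a `d`-swap: `P = Qᵀ P^{d↓}(i, j) Q` for a permutation matrix `Q` with `d↓ = Q d`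
and some `i ≤ j`. -/
def IsDSwap {n : ℕ} (d : Fin n → ℝ) (P : Matrix (Fin n) (Fin n) ℝ) : Prop :=
  ∃ σ : Equiv.Perm (Fin n),
    (σ.permMatrix ℝ).mulVec d = decreasingRearrangement d ∧
    ∃ i j : Fin n, i ≤ j ∧
      P = (σ.permMatrix ℝ).transpose * twoLevelSwap (decreasingRearrangement d) i j *
        σ.permMatrix ℝ

/-- `T` is a `T^d`-transform: `T = (1 - t) I + t P` for a `d`-swap `P` and some `0 ≤ t ≤ 1`. -/
def IsTTransform {n : ℕ} (d : Fin n → ℝ) (T : Matrix (Fin n) (Fin n) ℝ) : Prop :=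
  ∃ P : Matrix (Fin n) (Fin n) ℝ, IsDSwap d P ∧
    ∃ t : ℝ, 0 ≤ t ∧ t ≤ 1 ∧ T = (1 - t) • (1 : Matrix (Fin n) (Fin n) ℝ) + t • P

/-- The polytope of strong elementary thermal operations: the convex combinations of finite
products of `d`-swaps. -/
def etoPolytope {n : ℕ} (d : Fin n → ℝ) : Set (Matrix (Fin n) (Fin n) ℝ) :=
  convexHull ℝ {M | ∃ L : List (Matrix (Fin n) (Fin n) ℝ), (∀ P ∈ L, IsDSwap d P) ∧ M = L.prod}

/-- The polytope of weak elementary thermal operations: the finite products of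
`T^d`-transforms. -/
def wetoPolytope {n : ℕ} (d : Fin n → ℝ) : Set (Matrix (Fin n) (Fin n) ℝ) :=
  {M | ∃ L : List (Matrix (Fin n) (Fin n) ℝ), (∀ T ∈ L, IsTTransform d T) ∧ M = L.prod}

open Matrix

/-! For two levels there is one nontrivial swap `P`, and `P * P` lies on the segment from `1` to
`P`; that segment is thus closed under products, and both sets equal it. For three or more levels,
let `A`, `B` be swaps of two levels `i`, `j` with a common lower level `k`. Products of swaps are
countable, so some `M = (1 - a) • A + a • B` is not one of them. If `M` were a product of
transforms, some factor would be a genuine mixture, so nonnegativity would put the supports of both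
`X * Y` and `X * P * Y` inside that of `M`, with `P ≠ 1` (`mem_swapMonoid_or_exists_insertion`).
Their difference has rank at most one, zero column sums and kills `d`; the support of `M` forces it
to vanish (`vecMulVec_eq_zero_of_support`). Cancelling the invertible `X`, `Y` gives `P = 1`. -/

/-- The elementary matrix `twoLevelSwap` is a rank-one perturbation of the identity. -/
theorem twoLevelSwap_eq_one_add {n : ℕ} (e : Fin n → ℝ) (i j : Fin n) :
    twoLevelSwap e i j = 1 + vecMulVec (Pi.single i 1 - Pi.single j 1)
      (Pi.single j 1 - Pi.single i (e j / e i)) := by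
  ext k l
  by_cases hij : i = j
  · subst hij
    simp [twoLevelSwap]
  · simp only [twoLevelSwap, hij, if_false, of_apply, Matrix.add_apply, vecMulVec_apply, Pi.sub_apply,
      Pi.single_apply, one_apply]
    have hji : j ≠ i := fun h => hij h.symm
    by_cases hki : k = i <;> by_cases hkj : k = j <;> by_cases hli : l = i <;>
      by_cases hlj : l = j <;> (simp_all [eq_comm]; try ring)

theorem twoLevelSwap_nonneg {n : ℕ} {e : Fin n → ℝ} (he : ∀ i, 0 < e i) {i j : Fin n}
    (hij : e j ≤ e i) (k l : Fin n) : 0 ≤ twoLevelSwap e i j k l := by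
  have h1 : e j / e i ≤ 1 := (div_le_one (he i)).2 hij
  have h0 : 0 ≤ e j / e i := (div_pos (he j) (he i)).le
  by_cases h : i = j
  · simp only [twoLevelSwap, h, if_true, one_apply]
    split_ifs <;> norm_num
  · simp only [twoLevelSwap, h, if_false, of_apply]
    split_ifs <;> linarith

theorem one_vecMul_twoLevelSwap {n : ℕ} (e : Fin n → ℝ) (i j : Fin n) :
    1 ᵥ* twoLevelSwap e i j = 1 := by
  rw [twoLevelSwap_eq_one_add, vecMul_add, vecMul_one, vecMul_vecMulVec]
  simp [dotProduct_sub]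

theorem twoLevelSwap_mulVec {n : ℕ} {e : Fin n → ℝ} (he : ∀ i, 0 < e i) (i j : Fin n) :
    twoLevelSwap e i j *ᵥ e = e := by
  have := (he i).ne'
  rw [twoLevelSwap_eq_one_add, add_mulVec, one_mulVec, vecMulVec_mulVec]
  simp [sub_dotProduct, this]

/-- This is `(P - 1) * (P + g) = 0` for `g = e j / e i`. It yields both the inverse of `P` and, when
`g ≤ 1`, the closure of the segment under products. -/
theorem twoLevelSwap_mul_self {n : ℕ} (e : Fin n → ℝ) {i j : Fin n} (h : i ≠ j) :
    twoLevelSwap e i j * twoLevelSwap e i j =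
      (1 - e j / e i) • twoLevelSwap e i j + (e j / e i) • 1 := by
  set g := e j / e i with hg
  have h' : j ≠ i := h.symm
  rw [twoLevelSwap_eq_one_add, ← hg]
  set u : Fin n → ℝ := Pi.single i 1 - Pi.single j 1
  set v : Fin n → ℝ := Pi.single j 1 - Pi.single i g
  have huv : v ⬝ᵥ u = - g - 1 := by
    simp [u, v, h, h']
  have hsq : vecMulVec u v * vecMulVec u v = (- g - 1) • vecMulVec u v := by
    rw [vecMulVec_mul_vecMulVec, huv]
    ext; simp [vecMulVec_apply]; ring
  rw [mul_add, add_mul, add_mul, hsq]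
  simp only [one_mul, mul_one]
  module

theorem isUnit_twoLevelSwap {n : ℕ} {e : Fin n → ℝ} (he : ∀ i, 0 < e i) (i j : Fin n) :
    IsUnit (twoLevelSwap e i j) := by
  by_cases h : i = j
  · simp [twoLevelSwap, h]
  · have hg : e j / e i ≠ 0 := (div_pos (he j) (he i)).ne'
    have key := twoLevelSwap_mul_self e h
    set P := twoLevelSwap e i j
    refine IsUnit.of_mul_eq_one ((e j / e i)⁻¹ • (P - (1 - e j / e i) • 1)) ?_
    rw [mul_smul_comm, mul_sub, key, mul_smul_comm, mul_one, add_sub_cancel_left,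
      smul_smul, inv_mul_cancel₀ hg, one_smul]

theorem transpose_permMatrix_mul_mul_permMatrix {n : ℕ} (σ : Equiv.Perm (Fin n))
    (M : Matrix (Fin n) (Fin n) ℝ) :
    (σ.permMatrix ℝ)ᵀ * M * σ.permMatrix ℝ = M.submatrix σ.symm σ.symm := by
  ext k l
  simp [Equiv.Perm.permMatrix, PEquiv.toMatrix_toPEquiv_eq, mul_apply, one_apply,
    ← Equiv.symm_apply_eq]
  simp [← Equiv.eq_symm_apply]

theorem transpose_mul_twoLevelSwap_mul {n : ℕ} (σ : Equiv.Perm (Fin n)) (d : Fin n → ℝ)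
    (i j : Fin n) :
    (σ.permMatrix ℝ)ᵀ * twoLevelSwap (d ∘ σ) i j * σ.permMatrix ℝ =
      twoLevelSwap d (σ i) (σ j) := by
  rw [transpose_permMatrix_mul_mul_permMatrix]
  ext k l
  by_cases h : i = j
  · simp [twoLevelSwap, h, one_apply]
  · simp [twoLevelSwap, h, Equiv.symm_apply_eq]

theorem permMatrix_mulVec_eq {n : ℕ} (σ : Equiv.Perm (Fin n)) (d : Fin n → ℝ) :
    σ.permMatrix ℝ *ᵥ d = d ∘ σ := by
  ext i
  simp [Equiv.Perm.permMatrix, PEquiv.toMatrix_toPEquiv_mulVec]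

/-- Conjugation by `Q` only relabels levels, so sorting and the choice of `Q` drop out. -/
theorem IsDSwap.exists_twoLevelSwap {n : ℕ} {d : Fin n → ℝ} {P : Matrix (Fin n) (Fin n) ℝ}
    (hP : IsDSwap d P) : ∃ p q, d q ≤ d p ∧ P = twoLevelSwap d p q := by
  obtain ⟨σ, hσ, i, j, hij, rfl⟩ := hP
  rw [permMatrix_mulVec_eq] at hσ
  refine ⟨σ i, σ j, ?_, ?_⟩
  · have := decreasingRearrangement_antitone d hij
    rwa [← hσ] at this
  · rw [← hσ, transpose_mul_twoLevelSwap_mul]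

theorem isDSwap_sort {n : ℕ} (d : Fin n → ℝ) {i j : Fin n} (hij : i ≤ j) :
    IsDSwap d (twoLevelSwap d (Tuple.sort (fun i => -d i) i) (Tuple.sort (fun i => -d i) j)) := by
  refine ⟨Tuple.sort (fun i => -d i), permMatrix_mulVec_eq _ d, i, j, hij, ?_⟩
  rw [decreasingRearrangement, transpose_mul_twoLevelSwap_mul]

theorem sort_neg_antitone {n : ℕ} (d : Fin n → ℝ) {i j : Fin n} (hij : i ≤ j) :
    d (Tuple.sort (fun i => -d i) j) ≤ d (Tuple.sort (fun i => -d i) i) :=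
  decreasingRearrangement_antitone d hij

/-! ### Two levels -/

/-- By bilinearity only products of endpoints matter, and `P * P` is the only nontrivial one. -/
theorem segment_one_mul_mem {R : Type*} [Ring R] [Algebra ℝ R] {P x y : R}
    (hP : P * P ∈ segment ℝ 1 P) (hx : x ∈ segment ℝ 1 P) (hy : y ∈ segment ℝ 1 P) :
    x * y ∈ segment ℝ 1 P := by
  obtain ⟨a, b, ha, hb, hab, rfl⟩ := hx
  have hconv := convex_segment (𝕜 := ℝ) (1 : R) P
  have hPy : P * y ∈ segment ℝ 1 P := by
    obtain ⟨a', b', ha', hb', hab', rfl⟩ := hy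
    rw [mul_add, mul_smul_comm, mul_smul_comm, mul_one]
    exact hconv (right_mem_segment ℝ 1 P) hP ha' hb' hab'
  rw [add_mul, smul_mul_assoc, smul_mul_assoc, one_mul]
  exact hconv hy hPy ha hb hab

theorem list_prod_mem_segment_one {R : Type*} [Ring R] [Algebra ℝ R] {P : R}
    (hP : P * P ∈ segment ℝ 1 P) {L : List R} (hL : ∀ x ∈ L, x ∈ segment ℝ 1 P) :
    L.prod ∈ segment ℝ 1 P := by
  induction L with
  | nil => exact left_mem_segment ℝ 1 P
  | cons x L ih =>
    rw [List.prod_cons]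
    exact segment_one_mul_mem hP (hL x (by simp)) (ih fun y hy => hL y (by simp [hy]))

theorem twoLevelSwap_mul_self_mem_segment {n : ℕ} {e : Fin n → ℝ} (he : ∀ i, 0 < e i)
    {i j : Fin n} (hij : e j ≤ e i) :
    twoLevelSwap e i j * twoLevelSwap e i j ∈ segment ℝ 1 (twoLevelSwap e i j) := by
  by_cases h : i = j
  · simp [twoLevelSwap, h]
  · rw [twoLevelSwap_mul_self e h, add_comm]
    exact ⟨_, _, (div_pos (he j) (he i)).le, sub_nonneg.2 ((div_le_one (he i)).2 hij),
      by ring, rfl⟩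

/-- With tied levels `Q` is not unique and may yield either order; the swap is the same. -/
theorem twoLevelSwap_comm_of_eq {n : ℕ} {e : Fin n → ℝ} (he : ∀ i, 0 < e i) {i j : Fin n}
    (hij : e i = e j) : twoLevelSwap e i j = twoLevelSwap e j i := by
  have h1 : e j / e i = 1 := by rw [hij, div_self (he j).ne']
  have h2 : e i / e j = 1 := by rw [hij, div_self (he j).ne']
  rw [twoLevelSwap_eq_one_add, twoLevelSwap_eq_one_add, h1, h2]
  ext k l
  simp only [Matrix.add_apply, vecMulVec_apply, Pi.sub_apply]
  ring

theorem IsDSwap.mem_segment_of_two {d : Fin 2 → ℝ} (hpos : ∀ i, 0 < d i) {p q : Fin 2}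
    (hpq : p ≠ q) (hd : d q ≤ d p) {P : Matrix (Fin 2) (Fin 2) ℝ} (hP : IsDSwap d P) :
    P ∈ segment ℝ 1 (twoLevelSwap d p q) := by
  obtain ⟨r, s, hrs, rfl⟩ := hP.exists_twoLevelSwap
  by_cases h : r = s
  · have : twoLevelSwap d r s = 1 := by simp [twoLevelSwap, h]
    rw [this]
    exact left_mem_segment ℝ _ _
  · have hcases : (r = p ∧ s = q) ∨ (r = q ∧ s = p) := by omega
    rcases hcases with ⟨rfl, rfl⟩ | ⟨rfl, rfl⟩
    · exact right_mem_segment ℝ _ _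
    · rw [twoLevelSwap_comm_of_eq hpos (le_antisymm hd hrs)]
      exact right_mem_segment ℝ _ _

theorem etoPolytope_eq_wetoPolytope_of_two {d : Fin 2 → ℝ} (hpos : ∀ i, 0 < d i) :
    etoPolytope d = wetoPolytope d := by
  set p := Tuple.sort (fun i => -d i) 0
  set q := Tuple.sort (fun i => -d i) 1
  have hpq : p ≠ q := by simp [p, q]
  have hd : d q ≤ d p := sort_neg_antitone d (by simp)
  have hswap : IsDSwap d (twoLevelSwap d p q) := isDSwap_sort d (by simp)
  have hsq := twoLevelSwap_mul_self_mem_segment hpos hd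
  have hmem : ∀ P, IsDSwap d P → P ∈ segment ℝ 1 (twoLevelSwap d p q) :=
    fun P hP => hP.mem_segment_of_two hpos hpq hd
  have hconv := convex_segment (𝕜 := ℝ) 1 (twoLevelSwap d p q)
  trans segment ℝ 1 (twoLevelSwap d p q)
  · apply Set.Subset.antisymm
    · refine convexHull_min ?_ hconv
      rintro M ⟨L, hL, rfl⟩
      exact list_prod_mem_segment_one hsq fun P hP => hmem P (hL P hP)
    · refine (convex_convexHull ℝ _).segment_subset (subset_convexHull ℝ _ ⟨[], by simp⟩)
        (subset_convexHull ℝ _ ⟨[twoLevelSwap d p q], by simpa using hswap⟩)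
  · apply Set.Subset.antisymm
    · rintro M ⟨a, b, ha, hb, hab, rfl⟩
      refine ⟨[a • 1 + b • twoLevelSwap d p q], ?_, by simp⟩
      simp only [List.mem_singleton, forall_eq]
      exact ⟨_, hswap, b, hb, by linarith, by rw [← hab, add_sub_cancel_right]⟩
    · rintro M ⟨L, hL, rfl⟩
      refine list_prod_mem_segment_one hsq fun T hT => ?_
      obtain ⟨P, hP, t, ht0, ht1, rfl⟩ := hL T hT
      exact hconv (left_mem_segment ℝ _ _) (hmem P hP) (by linarith) ht0 (by ring)

/-! ### At least three levels -/

/-- The monoid generated by the `d`-swaps. -/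
def swapMonoid {n : ℕ} (d : Fin n → ℝ) : Submonoid (Matrix (Fin n) (Fin n) ℝ) :=
  Submonoid.closure {P | IsDSwap d P}

theorem countable_setOf_isDSwap {n : ℕ} (d : Fin n → ℝ) : {P | IsDSwap d P}.Countable := by
  refine (Set.countable_range
    fun pq : Fin n × Fin n => twoLevelSwap d pq.1 pq.2).mono ?_
  intro P hP
  obtain ⟨p, q, -, rfl⟩ := IsDSwap.exists_twoLevelSwap hP
  exact ⟨(p, q), rfl⟩

theorem countable_swapMonoid {n : ℕ} (d : Fin n → ℝ) :
    (swapMonoid d : Set (Matrix (Fin n) (Fin n) ℝ)).Countable := by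
  have : Countable {P | IsDSwap d P} := (countable_setOf_isDSwap d).to_subtype
  rw [swapMonoid, Submonoid.closure_eq_mrange, MonoidHom.coe_mrange]
  have : Countable (FreeMonoid {P | IsDSwap d P}) :=
    inferInstanceAs (Countable (List {P | IsDSwap d P}))
  exact Set.countable_range _

theorem nonneg_of_mem_swapMonoid {n : ℕ} {d : Fin n → ℝ} (hpos : ∀ i, 0 < d i)
    {X : Matrix (Fin n) (Fin n) ℝ} (hX : X ∈ swapMonoid d) (k l : Fin n) : 0 ≤ X k l := by
  induction hX using Submonoid.closure_induction generalizing k l with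
  | mem P hP =>
    obtain ⟨p, q, hpq, rfl⟩ := IsDSwap.exists_twoLevelSwap hP
    exact twoLevelSwap_nonneg hpos hpq k l
  | one => rw [one_apply]; split_ifs <;> norm_num
  | mul X Y _ _ hX hY =>
    rw [mul_apply]
    exact Finset.sum_nonneg fun m _ => mul_nonneg (hX k m) (hY m l)

theorem one_vecMul_of_mem_swapMonoid {n : ℕ} {d : Fin n → ℝ}
    {X : Matrix (Fin n) (Fin n) ℝ} (hX : X ∈ swapMonoid d) : 1 ᵥ* X = 1 := by
  induction hX using Submonoid.closure_induction with
  | mem P hP =>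
    obtain ⟨p, q, -, rfl⟩ := IsDSwap.exists_twoLevelSwap hP
    exact one_vecMul_twoLevelSwap d p q
  | one => exact vecMul_one _
  | mul X Y _ _ hX hY => rw [← vecMul_vecMul, hX, hY]

theorem mulVec_of_mem_swapMonoid {n : ℕ} {d : Fin n → ℝ} (hpos : ∀ i, 0 < d i)
    {X : Matrix (Fin n) (Fin n) ℝ} (hX : X ∈ swapMonoid d) : X *ᵥ d = d := by
  induction hX using Submonoid.closure_induction with
  | mem P hP =>
    obtain ⟨p, q, -, rfl⟩ := IsDSwap.exists_twoLevelSwap hP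
    exact twoLevelSwap_mulVec hpos p q
  | one => exact one_mulVec _
  | mul X Y _ _ hX hY => rw [← mulVec_mulVec, hY, hX]

theorem isUnit_of_mem_swapMonoid {n : ℕ} {d : Fin n → ℝ} (hpos : ∀ i, 0 < d i)
    {X : Matrix (Fin n) (Fin n) ℝ} (hX : X ∈ swapMonoid d) : IsUnit X := by
  induction hX using Submonoid.closure_induction with
  | mem P hP =>
    obtain ⟨p, q, -, rfl⟩ := IsDSwap.exists_twoLevelSwap hP
    exact isUnit_twoLevelSwap hpos p q
  | one => exact isUnit_one
  | mul X Y _ _ hX hY => exact hX.mul hY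

/-! ### Zero patterns of products of transforms -/

/-- The zero entries of `M` are zero entries of `N`. -/
def ZerosSubset {n : ℕ} (M N : Matrix (Fin n) (Fin n) ℝ) : Prop :=
  ∀ k l, M k l = 0 → N k l = 0

theorem ZerosSubset.convex_comb {n : ℕ} {M N A : Matrix (Fin n) (Fin n) ℝ} {t : ℝ} (ht0 : 0 ≤ t)
    (ht1 : t < 1) (hM : ∀ k l, 0 ≤ M k l) (hN : ∀ k l, 0 ≤ N k l) (h : ZerosSubset M A) :
    ZerosSubset ((1 - t) • M + t • N) A := by
  intro k l hkl
  apply h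
  have h1 : 0 < 1 - t := by linarith
  simp only [Matrix.add_apply, Matrix.smul_apply, smul_eq_mul] at hkl
  have h2 := mul_nonneg ht0 (hN k l)
  have h3 := mul_nonneg h1.le (hM k l)
  have h4 : (1 - t) * M k l = 0 := by linarith
  exact (mul_eq_zero.1 h4).resolve_left h1.ne'

theorem ZerosSubset.mul_left {n : ℕ} {M N P : Matrix (Fin n) (Fin n) ℝ}
    (hP : ∀ k l, 0 ≤ P k l) (hM : ∀ k l, 0 ≤ M k l) (h : ZerosSubset M N) :
    ZerosSubset (P * M) (P * N) := by
  intro k l hkl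
  rw [mul_apply, Finset.sum_eq_zero_iff_of_nonneg
    (fun m _ => mul_nonneg (hP k m) (hM m l))] at hkl
  rw [mul_apply]
  refine Finset.sum_eq_zero fun m hm => ?_
  rcases mul_eq_zero.1 (hkl m hm) with h0 | h0
  · rw [h0, zero_mul]
  · rw [h m l h0, mul_zero]

theorem mul_nonneg_entries {n : ℕ} {M N : Matrix (Fin n) (Fin n) ℝ}
    (hM : ∀ k l, 0 ≤ M k l) (hN : ∀ k l, 0 ≤ N k l) (k l : Fin n) : 0 ≤ (M * N) k l := by
  rw [mul_apply]
  exact Finset.sum_nonneg fun m _ => mul_nonneg (hM k m) (hN m l)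

/-- A product of `T^d`-transforms is either a product of `d`-swaps or its support contains the
supports of two products of `d`-swaps that differ by the insertion of one nontrivial `d`-swap. -/
theorem mem_swapMonoid_or_exists_insertion {n : ℕ} {d : Fin n → ℝ} (hpos : ∀ i, 0 < d i)
    {L : List (Matrix (Fin n) (Fin n) ℝ)} (hL : ∀ T ∈ L, IsTTransform d T) :
    (∀ k l, 0 ≤ L.prod k l) ∧ (L.prod ∈ swapMonoid d ∨
      ∃ X ∈ swapMonoid d, ∃ Y ∈ swapMonoid d, ∃ P, IsDSwap d P ∧ P ≠ 1 ∧
        ZerosSubset L.prod (X * Y) ∧ ZerosSubset L.prod (X * P * Y)) := by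
  induction L with
  | nil =>
    have h1 : (1 : Matrix (Fin n) (Fin n) ℝ) ∈ swapMonoid d := one_mem _
    exact ⟨nonneg_of_mem_swapMonoid hpos h1, Or.inl h1⟩
  | cons T L ih =>
    obtain ⟨hN, ih⟩ := ih fun T hT => hL T (by simp [hT])
    obtain ⟨P, hP, t, ht0, ht1, rfl⟩ := hL T (by simp)
    have hPmem : P ∈ swapMonoid d := Submonoid.subset_closure hP
    have hP0 := nonneg_of_mem_swapMonoid hpos hPmem
    rw [List.prod_cons]
    set N := L.prod
    have hPN := mul_nonneg_entries hP0 hN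
    have hprod : ((1 - t) • (1 : Matrix (Fin n) (Fin n) ℝ) + t • P) * N =
        (1 - t) • N + t • (P * N) := by
      rw [add_mul, smul_mul_assoc, smul_mul_assoc, one_mul]
    rw [hprod]
    refine ⟨fun k l => ?_, ?_⟩
    · simp only [Matrix.add_apply, Matrix.smul_apply, smul_eq_mul]
      exact add_nonneg (mul_nonneg (by linarith) (hN k l)) (mul_nonneg ht0 (hPN k l))
    rcases ht1.eq_or_lt with rfl | ht1
    · have h1 : (1 - 1 : ℝ) • N + (1 : ℝ) • (P * N) = P * N := by simp
      rw [h1]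
      rcases ih with ih | ⟨X, hX, Y, hY, P', hP', hne, h1, h2⟩
      · exact Or.inl (mul_mem hPmem ih)
      · refine Or.inr ⟨P * X, mul_mem hPmem hX, Y, hY, P', hP', hne, ?_, ?_⟩
        · rw [mul_assoc]
          exact h1.mul_left hP0 hN
        · rw [mul_assoc P X P', mul_assoc P]
          exact h2.mul_left hP0 hN
    · rcases ih with ih | ⟨X, hX, Y, hY, P', hP', hne, h1, h2⟩
      · by_cases h1 : P = 1
        · left
          rwa [h1, one_mul, ← add_smul, sub_add_cancel, one_smul]
        · rcases ht0.eq_or_lt with rfl | ht0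
          · left
            simpa using ih
          -- The first genuine mixture, reading from the right: both `N` and `P * N` have positive
          -- weight, so neither support is lost.
          · refine Or.inr ⟨1, one_mem _, N, ih, P, hP, h1, ?_, ?_⟩
            · rw [one_mul]
              exact ZerosSubset.convex_comb ht0.le ht1 hN hPN fun _ _ h => h
            · rw [one_mul, add_comm]
              have := ZerosSubset.convex_comb (M := P * N) (N := N) (A := P * N) (t := 1 - t)
                (by linarith) (by linarith) hPN hN fun _ _ h => h
              rwa [sub_sub_cancel] at this
      · exact Or.inr ⟨X, hX, Y, hY, P', hP', hne, h1.convex_comb ht0 ht1 hN hPN,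
          h2.convex_comb ht0 ht1 hN hPN⟩

/-! ### The rank-one obstruction -/

/-- A matrix of rank at most one with zero column sums, annihilating a positive vector `d` and
supported on the diagonal entries other than `(k, k)` and on the entries `(i, k)`, `(k, i)`,
`(j, k)`, `(k, j)` vanishes. -/
theorem vecMulVec_eq_zero_of_support {n : ℕ} {d x y : Fin n → ℝ} (hpos : ∀ i, 0 < d i)
    {i j k : Fin n} (hij : i ≠ j) (hik : i ≠ k) (hjk : j ≠ k)
    (hsum : 1 ᵥ* vecMulVec x y = 0) (hmul : vecMulVec x y *ᵥ d = 0)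
    (hkk : vecMulVec x y k k = 0)
    (hsupp : ∀ r s, r ≠ s → (r, s) ≠ (i, k) → (r, s) ≠ (k, i) → (r, s) ≠ (j, k) →
      (r, s) ≠ (k, j) → vecMulVec x y r s = 0) : vecMulVec x y = 0 := by
  set D := vecMulVec x y with hD
  have hcol : ∀ s, ∑ r, D r s = 0 := fun s => by
    simpa [vecMul, dotProduct] using congrFun hsum s
  have hrow : ∀ r, ∑ s, D r s * d s = 0 := fun r => by
    simpa [mulVec, dotProduct] using congrFun hmul r
  have hck : D i k + D j k = 0 := by
    rw [← hcol k, Fintype.sum_eq_add i j hij]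
    intro r hr
    by_cases h : r = k
    · rw [h, hkk]
    · exact hsupp r k h (by simp [hr.1]) (by simp [h]) (by simp [hr.2]) (by simp [h])
  have hri : D i i * d i + D i k * d k = 0 := by
    rw [← hrow i, Fintype.sum_eq_add i k hik]
    intro s hs
    rw [hsupp i s hs.1.symm (by simp [hs.2]) (by simp [hik]) (by simp [hij]) (by simp [hik]),
      zero_mul]
  have hrj : D j j * d j + D j k * d k = 0 := by
    rw [← hrow j, Fintype.sum_eq_add j k hjk]
    intro s hs
    rw [hsupp j s hs.1.symm (by simp [hij.symm]) (by simp [hjk]) (by simp [hs.2])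
      (by simp [hjk]), zero_mul]
  have hji : D j i = 0 :=
    hsupp j i hij.symm (by simp [hik]) (by simp [hjk]) (by simp [hik]) (by simp [hij])
  -- The only use of rank one. As `D j i = 0`, the minor gives `D i i * D j k = 0`, and the sums
  -- above turn this into `D i k ^ 2 * d k = 0`.
  have hminor : D i i * D j k = D i k * D j i := by
    simp only [hD, vecMulVec_apply]; ring
  have hDik : D i k = 0 := by
    rw [hji, mul_zero] at hminor
    have h1 : D i k * (D i k * d k) = 0 := by
      linear_combination D i k * hri - D i i * d i * hck + d i * hminor
    have h2 := (hpos k).ne'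
    simpa [h2] using h1
  have hDjk : D j k = 0 := by linarith
  have hDii : D i i = 0 := by
    simpa [hDik, (hpos i).ne'] using hri
  have hDjj : D j j = 0 := by
    simpa [hDjk, (hpos j).ne'] using hrj
  -- Outside row `k` only the diagonal is left; the row relations kill it, then column sums kill row
  -- `k`.
  have hdiag : ∀ r s, r ≠ s → r ≠ k → D r s = 0 := by
    intro r s hrs hrk
    by_cases h1 : (r, s) = (i, k)
    · rw [Prod.mk.injEq] at h1; rw [h1.1, h1.2, hDik]
    by_cases h2 : (r, s) = (j, k)
    · rw [Prod.mk.injEq] at h2; rw [h2.1, h2.2, hDjk]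
    exact hsupp r s hrs h1 (by simp [hrk]) h2 (by simp [hrk])
  have hrr : ∀ r, D r r = 0 := by
    intro r
    by_cases h1 : r = k
    · rw [h1, hkk]
    have := hrow r
    rw [Fintype.sum_eq_single r fun s hs => by rw [hdiag r s hs.symm h1, zero_mul]] at this
    simpa [(hpos r).ne'] using this
  ext r s
  rw [Matrix.zero_apply]
  by_cases hrs : r = s
  · rw [hrs, hrr]
  by_cases hrk : r = k
  · subst hrk
    have := hcol s
    rw [Fintype.sum_eq_single r] at this
    · exact this
    · intro m hm
      by_cases hms : m = s
      · rw [hms, hrr]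
      · exact hdiag m s hms hm
  · exact hdiag r s hrs hrk

theorem not_zerosSubset_insertion {n : ℕ} {d : Fin n → ℝ} (hpos : ∀ i, 0 < d i)
    {i j k : Fin n} (hij : i ≠ j) (hik : i ≠ k) (hjk : j ≠ k) {a : ℝ}
    {X Y P : Matrix (Fin n) (Fin n) ℝ} (hX : X ∈ swapMonoid d) (hY : Y ∈ swapMonoid d)
    (hP : IsDSwap d P) (hne : P ≠ 1)
    (h1 : ZerosSubset ((1 - a) • twoLevelSwap d i k + a • twoLevelSwap d j k) (X * Y))
    (h2 : ZerosSubset ((1 - a) • twoLevelSwap d i k + a • twoLevelSwap d j k) (X * P * Y)) :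
    False := by
  have hPm : P ∈ swapMonoid d := Submonoid.subset_closure hP
  have hXPY := mul_mem (mul_mem hX hPm) hY
  have hXY := mul_mem hX hY
  obtain ⟨p, q, -, hpq⟩ := hP.exists_twoLevelSwap
  obtain ⟨x, y, hxy⟩ : ∃ x y, X * P * Y - X * Y = vecMulVec x y := by
    refine ⟨X *ᵥ (Pi.single p 1 - Pi.single q 1),
      (Pi.single q 1 - Pi.single p (d q / d p)) ᵥ* Y, ?_⟩
    rw [hpq, twoLevelSwap_eq_one_add, mul_add, add_mul, mul_one, add_sub_cancel_left,
      mul_vecMulVec, vecMulVec_mul]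
  have hzero : ∀ r s, ((1 - a) • twoLevelSwap d i k + a • twoLevelSwap d j k) r s = 0 →
      vecMulVec x y r s = 0 := by
    intro r s h
    rw [← hxy, Matrix.sub_apply, h1 r s h, h2 r s h, sub_zero]
  have hD : vecMulVec x y = 0 := by
    refine vecMulVec_eq_zero_of_support hpos hij hik hjk ?_ ?_ ?_ ?_
    · rw [← hxy, vecMul_sub, one_vecMul_of_mem_swapMonoid hXPY,
        one_vecMul_of_mem_swapMonoid hXY, sub_self]
    · rw [← hxy, sub_mulVec, mulVec_of_mem_swapMonoid hpos hXPY,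
        mulVec_of_mem_swapMonoid hpos hXY, sub_self]
    · apply hzero
      simp [twoLevelSwap, hik, hjk, hik.symm, hjk.symm]
    · intro r s hrs h1 h2 h3 h4
      apply hzero
      simp only [ne_eq, Prod.mk.injEq] at h1 h2 h3 h4
      have e1 : twoLevelSwap d i k r s = 0 := by
        simp only [twoLevelSwap, hik, if_false, of_apply]
        grind
      have e2 : twoLevelSwap d j k r s = 0 := by
        simp only [twoLevelSwap, hjk, if_false, of_apply]
        grind
      simp [e1, e2]
  rw [hD, sub_eq_zero] at hxy
  have h3 := (isUnit_of_mem_swapMonoid hpos hY).mul_right_cancel hxy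
  exact hne ((isUnit_of_mem_swapMonoid hpos hX).mul_left_cancel (h3.trans (mul_one X).symm))

theorem exists_convex_comb_notMem {E : Type*} [AddCommGroup E] [Module ℝ E]
    {S : Set E} (hS : S.Countable) {A B : E} (hAB : A ≠ B) :
    ∃ a : ℝ, 0 ≤ a ∧ a ≤ 1 ∧ (1 - a) • A + a • B ∉ S := by
  by_contra! h
  have hinj : Function.Injective fun a : ℝ => (1 - a) • A + a • B := by
    intro a b hab
    have h0 : (a - b) • (B - A) = 0 := by
      have : (1 - a) • A + a • B - ((1 - b) • A + b • B) = 0 := sub_eq_zero.2 hab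
      rw [← this]
      module
    rcases smul_eq_zero.1 h0 with h0 | h0
    · exact sub_eq_zero.1 h0
    · exact absurd (sub_eq_zero.1 h0).symm hAB
  have hc : (Set.Icc (0 : ℝ) 1).Countable :=
    (hS.preimage hinj).mono fun a ha => h a ha.1 ha.2
  exact absurd hc (Cardinal.Real.Icc_countable_iff.not.2 (by norm_num))

theorem etoPolytope_ne_wetoPolytope {n : ℕ} (hn : 3 ≤ n) {d : Fin n → ℝ} (hpos : ∀ i, 0 < d i) :
    etoPolytope d ≠ wetoPolytope d := by
  intro heq
  set σ := Tuple.sort (fun i => -d i)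
  -- Three largest levels, in sorted order: both swaps go down to the third, so both have a zero at
  -- its diagonal entry.
  let f : Fin 3 → Fin n := Fin.castLE hn
  have hf : ∀ r s : Fin 3, r ≠ s → σ (f r) ≠ σ (f s) := fun r s hrs h =>
    hrs (Fin.castLE_injective hn (σ.injective h))
  have hik := hf 0 2 (by decide)
  have hjk := hf 1 2 (by decide)
  have hij := hf 0 1 (by decide)
  have hA : IsDSwap d (twoLevelSwap d (σ (f 0)) (σ (f 2))) :=
    isDSwap_sort d (Fin.castLE_le_castLE_iff hn |>.2 (by decide))
  have hB : IsDSwap d (twoLevelSwap d (σ (f 1)) (σ (f 2))) :=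
    isDSwap_sort d (Fin.castLE_le_castLE_iff hn |>.2 (by decide))
  have hAB : twoLevelSwap d (σ (f 0)) (σ (f 2)) ≠ twoLevelSwap d (σ (f 1)) (σ (f 2)) := by
    intro h
    have := congrFun (congrFun h (σ (f 0))) (σ (f 2))
    simp only [twoLevelSwap, hik, hjk, hij, hik.symm, if_false, of_apply] at this
    simp at this
  obtain ⟨a, ha0, ha1, ha⟩ := exists_convex_comb_notMem (countable_swapMonoid d) hAB
  have hgen : ∀ P, IsDSwap d P → P ∈ etoPolytope d := fun P hP =>
    subset_convexHull ℝ _ ⟨[P], by simpa using hP, by simp⟩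
  have hmem : (1 - a) • twoLevelSwap d (σ (f 0)) (σ (f 2)) +
      a • twoLevelSwap d (σ (f 1)) (σ (f 2)) ∈ etoPolytope d :=
    convex_convexHull ℝ _ (hgen _ hA) (hgen _ hB) (by linarith) ha0 (by ring)
  rw [heq] at hmem
  obtain ⟨L, hL, hLM⟩ := hmem
  rw [hLM] at ha
  obtain ⟨-, h | ⟨X, hX, Y, hY, P, hP, hne, h1, h2⟩⟩ := mem_swapMonoid_or_exists_insertion hpos hL
  · exact ha h
  · rw [← hLM] at h1 h2
    exact not_zerosSubset_insertion hpos hij hik hjk hX hY hP hne h1 h2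

theorem mainTheorem5 (n : ℕ) (hn : 2 ≤ n) (d : Fin n → ℝ)
    (hd : d ∈ stdSimplex ℝ (Fin n)) (hpos : ∀ i, 0 < d i) :
    etoPolytope d = wetoPolytope d ↔ n = 2 := by
  constructor
  · intro h
    by_contra hne
    exact etoPolytope_ne_wetoPolytope (by omega) hpos h
  · rintro rfl
    exact etoPolytope_eq_wetoPolytope_of_two hpos
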